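/- **Setting.** Let $n\ge 2$, let $\mathcal C_n=\langle\omega:\omega^n=1\rangle$ be the cyclic group of order $n$, and let $G$ be a finite simple graph with an injective homomorphism $\mathcal C_n\to\operatorname{Aut}(G)$; write $\gamma v$ for the action. A vertex $v$ is *invariant* if $\gamma v=v$ for all $\gamma\in\mathcal C_n$, and *partially invariant* if $\gamma v=v$ for some $\gamma\ne 1$. The graph $G$ is *$\mathcal C_n$-symmetric* if every partially invariant vertex is invariant and the invariant vertices form an independent set. **Proper flexible placements.** A *placement* of $G$ is a map $p:V(G)\to\mathbb R^2$ with $p(u)\ne p(v)$ for every edge $uv$; it is *$\mathcal C_n$-symmetric* if $p(\omega^k v)=\tau(\omega^k)p(v)$ for all $k$ and $v$, where $\tau(\omega^k)$ is the rotation about the origin by $2k\pi/n$. It is a *proper $\mathcal C_n$-symmetric flexible placement* if there is a continuous path $t\mapsto p_t$, $t\in[0,1]$, of $\mathcal C_n$-symmetric placements of $G$ with $p_0=p$ such that $\|p_t(u)-p_t(v)\|=\|p(u)-p(v)\|$ for all $t$ and all edges $uv$; for some $t$ and some vertices $u,v$ one has $\|p_t(u)-p_t(v)\|\neq\|p(u)-p(v)\|$;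 and all but finitely many of the placements $p_t$ are injective. **NAC-colourings.** A *NAC-colouring* of $G$ is a surjective map $\delta:E(G)\to\{\text{red},\text{blue}\}$ such that every cycle of $G$ is monochromatic or has at least two red and at least two blue edges. The red (blue) components are the connected components of the spanning subgraph of all red (blue) edges; such a component $H$ is *partially invariant* if $\gamma H=H$ for some $\gamma\ne1$. A NAC-colouring $\delta$ is *$\mathcal C_n$-symmetric* if $\delta(\gamma e)=\delta(e)$ for all edges $e$ and all $\gamma\in\mathcal C_n$, and no two distinct partially invariant red components, and no two distinct partially invariant blue components, are connected by an edge of $G$. **Closure.** Let $U(G)$ be the set of pairs $\{u,v\}$ of distinct non-adjacent vertices for which there is a path in $G$ from $u$ to $v$ that is monochromatic for every $\mathcal C_n$-symmetric NAC-colouring of $G$. Put $G_0=G$ and $G_{i+1}=(V(G),E(G_i)\cup U(G_i))$; the group $\mathcal C_n$ acts on each $G_i$ by automorphisms, and the definitions above are applied to $G_i$ with this action (also if two invariant vertices become adjacent). Since $G$ is finite, $U(G_m)=\emptyset$ for some $m$; for the least such $m$, the graph $G_m$ is the *$\mathcal C_n$-symmetric constant distance closure* of $G$. **Theorem.** A $\mathcal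 C_n$-symmetric graph $G$ has a proper $\mathcal C_n$-symmetric flexible placement if and only if its $\mathcal C_n$-symmetric constant distance closure has one. In particular, if the closure is complete, then $G$ has no proper $\mathcal C_n$-symmetric flexible placement. -/

import Mathlib

namespace CnSym

/-- The Euclidean plane. -/
abbrev Plane : Type := EuclideanSpace ℝ (Fin 2)

/-- The cyclic group of order `n`, written multiplicatively; `ω` is `Multiplicative.ofAdd 1`. -/
abbrev Cn (n : ℕ) : Type := Multiplicative (ZMod n)

/-- The two colours. -/
inductive Colour : Type
  | red
  | blue

section Symmetry

variable {V : Type*} {n : ℕ}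

/-- `v` is fixed by the whole group. -/
def IsInvariant (θ : Cn n →* Equiv.Perm V) (v : V) : Prop :=
  ∀ γ : Cn n, θ γ v = v

/-- `v` is fixed by some non-trivial group element. -/
def IsPartiallyInvariant (θ : Cn n →* Equiv.Perm V) (v : V) : Prop :=
  ∃ γ : Cn n, γ ≠ 1 ∧ θ γ v = v

/-- `G` is `C_n`-symmetric with respect to the action `θ` of `C_n` on its vertices: `θ` is injective
and takes values in the automorphisms of `G`, each partially invariant vertex is invariant, and the
invariant vertices are independent. -/
structure IsSymmetricGraph (θ : Cn n →* Equiv.Perm V) (G : SimpleGraph V) : Prop where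
  injective : Function.Injective θ
  adj_iff : ∀ (γ : Cn n) (u v : V), G.Adj (θ γ u) (θ γ v) ↔ G.Adj u v
  invariant_of_partially : ∀ v, IsPartiallyInvariant θ v → IsInvariant θ v
  independent : ∀ u v, IsInvariant θ u → IsInvariant θ v → ¬ G.Adj u v

/-! Frameworks and flexes. -/

/-- A placement of `G`: adjacent vertices are mapped to distinct points. -/
def IsPlacement (G : SimpleGraph V) (p : V → Plane) : Prop :=
  ∀ u v, G.Adj u v → p u ≠ p v

/-- The frameworks `(G, p)` and `(G, q)` have the same edge lengths. -/
def AreEquivalent (G : SimpleGraph V) (p q : V → Plane) : Prop :=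
  ∀ u v, G.Adj u v → ‖p u - p v‖ = ‖q u - q v‖

/-- All pairwise distances agree. -/
def AreCongruent (p q : V → Plane) : Prop :=
  ∀ u v, ‖p u - p v‖ = ‖q u - q v‖

/-- Anticlockwise rotation about the origin by the angle `α`. -/
noncomputable def rotate (α : ℝ) (x : Plane) : Plane :=
  !₂[Real.cos α * x 0 - Real.sin α * x 1, Real.sin α * x 0 + Real.cos α * x 1]

/-- The placement is `C_n`-symmetric: `ω ^ k` acts as the rotation by `2 k π / n`. -/
def IsSymmetricPlacement (θ : Cn n →* Equiv.Perm V) (p : V → Plane) : Prop :=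
  ∀ (γ : Cn n) (v : V),
    p (θ γ v) = rotate (2 * ((Multiplicative.toAdd γ).val : ℝ) * Real.pi / (n : ℝ)) (p v)

/-- A flex of `(G, p)`. -/
structure IsFlex (G : SimpleGraph V) (p : V → Plane) (f : unitInterval → V → Plane) : Prop where
  continuous : Continuous f
  start : f 0 = p
  placement : ∀ t, IsPlacement G (f t)
  equivalent : ∀ t, AreEquivalent G (f t) p

/-- `(G, p)` is a proper `C_n`-symmetric flexible framework: it is a `C_n`-symmetric framework with a
non-trivial flex through `C_n`-symmetric placements, all but finitely many of which are injective. -/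
def IsProperFlexible (θ : Cn n →* Equiv.Perm V) (G : SimpleGraph V) (p : V → Plane) : Prop :=
  IsPlacement G p ∧ IsSymmetricPlacement θ p ∧
    ∃ f : unitInterval → V → Plane,
      IsFlex G p f ∧
      (∃ t, ¬ AreCongruent (f t) p) ∧
      (∀ t, IsSymmetricPlacement θ (f t)) ∧
      {q : V → Plane | q ∈ Set.range f ∧ ¬ Function.Injective q}.Finite

/-- `G` admits a proper `C_n`-symmetric flexible placement. -/
def AdmitsProperFlexible (θ : Cn n →* Equiv.Perm V) (G : SimpleGraph V) : Prop :=
  ∃ p : V → Plane, IsProperFlexible θ G p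

/-! NAC-colourings. -/

/-- All edges of the walk have the same colour. -/
def IsMonochromatic {G : SimpleGraph V} (δ : G.edgeSet → Colour) {u v : V} (w : G.Walk u v) : Prop :=
  ∀ e f : G.edgeSet, (e : Sym2 V) ∈ w.edges → (f : Sym2 V) ∈ w.edges → δ e = δ f

/-- NAC-colourings: both colours occur, and each cycle is monochromatic or has at least two edges of
each colour. -/
def IsNAC {G : SimpleGraph V} (δ : G.edgeSet → Colour) : Prop :=
  Function.Surjective δ ∧
    ∀ (v : V) (c : G.Walk v v), c.IsCycle →
      IsMonochromatic δ c ∨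
        ∀ col : Colour, 2 ≤ {e : G.edgeSet | (e : Sym2 V) ∈ c.edges ∧ δ e = col}.ncard

/-- The spanning subgraph formed by the edges of one colour. -/
def colourGraph {G : SimpleGraph V} (δ : G.edgeSet → Colour) (col : Colour) : SimpleGraph V :=
  SimpleGraph.fromEdgeSet (Subtype.val '' {e : G.edgeSet | δ e = col})

/-- The set `H` is mapped onto itself by some non-trivial group element. -/
def IsPartiallyInvariantSet (θ : Cn n →* Equiv.Perm V) (H : Set V) : Prop :=
  ∃ γ : Cn n, γ ≠ 1 ∧ θ γ '' H = H

/-- `C_n`-symmetric NAC-colourings: NAC-colourings invariant under the action, such that no two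
distinct partially invariant components of the same colour are connected by an edge. (For an
invariant colouring, a component of one colour is mapped onto itself exactly when its vertex set
is.) -/
structure IsSymmetricNAC (θ : Cn n →* Equiv.Perm V) {G : SimpleGraph V}
    (δ : G.edgeSet → Colour) : Prop where
  nac : IsNAC δ
  invariant : ∀ (γ : Cn n) (e e' : G.edgeSet),
    (e' : Sym2 V) = Sym2.map (θ γ) (e : Sym2 V) → δ e' = δ e
  separated : ∀ (col : Colour) (H₁ H₂ : (colourGraph δ col).ConnectedComponent), H₁ ≠ H₂ →
    IsPartiallyInvariantSet θ H₁.supp → IsPartiallyInvariantSet θ H₂.supp →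
      ∀ u ∈ H₁.supp, ∀ v ∈ H₂.supp, ¬ G.Adj u v

/-! The constant distance closure. -/

/-- The pairs of distinct non-adjacent vertices which are joined by a path that is monochromatic for
all `C_n`-symmetric NAC-colourings of `G`. -/
def monoPairs (θ : Cn n →* Equiv.Perm V) (G : SimpleGraph V) : Set (Sym2 V) :=
  {e | ∃ u v : V, e = s(u, v) ∧ u ≠ v ∧ ¬ G.Adj u v ∧
    ∃ P : G.Walk u v, P.IsPath ∧
      ∀ δ : G.edgeSet → Colour, IsSymmetricNAC θ δ → IsMonochromatic δ P}

/-- The graph obtained from `G` by adding all pairs in `monoPairs`. -/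
def addMonoPairs (θ : Cn n →* Equiv.Perm V) (G : SimpleGraph V) : SimpleGraph V :=
  SimpleGraph.fromEdgeSet (G.edgeSet ∪ monoPairs θ G)

/-- The sequence `G = G_0, G_1, G_2, …`. -/
def closureSeq (θ : Cn n →* Equiv.Perm V) (G : SimpleGraph V) : ℕ → SimpleGraph V
  | 0 => G
  | k + 1 => addMonoPairs θ (closureSeq θ G k)

theorem le_addMonoPairs (θ : Cn n →* Equiv.Perm V) (G : SimpleGraph V) :
    G ≤ addMonoPairs θ G := by
  intro u v h
  exact (SimpleGraph.fromEdgeSet_adj _).2 ⟨Or.inl h, h.ne⟩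

/-- The sequence reaches a graph to which nothing has to be added. -/
theorem exists_monoPairs_eq_empty [Finite V] (θ : Cn n →* Equiv.Perm V) (G : SimpleGraph V) :
    ∃ k, monoPairs θ (closureSeq θ G k) = ∅ := by
  have hm : Monotone (closureSeq θ G) :=
    monotone_nat_of_le_succ fun k => le_addMonoPairs θ _
  obtain ⟨k, hk⟩ := WellFoundedGT.monotone_chain_condition ⟨closureSeq θ G, hm⟩
  refine ⟨k, Set.eq_empty_iff_forall_notMem.2 ?_⟩
  rintro e ⟨u, v, rfl, huv, hn, hP⟩
  have h : closureSeq θ G k = addMonoPairs θ (closureSeq θ G k) := hk (k + 1) (Nat.le_succ k)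
  apply hn
  rw [h]
  exact (SimpleGraph.fromEdgeSet_adj _).2 ⟨Or.inr ⟨u, v, rfl, huv, hn, hP⟩, huv⟩

open Classical in
/-- The `C_n`-symmetric constant distance closure of `G`: the first graph of the sequence to which
nothing has to be added. -/
noncomputable def constantDistanceClosure [Finite V] (θ : Cn n →* Equiv.Perm V)
    (G : SimpleGraph V) : SimpleGraph V :=
  closureSeq θ G (Nat.find (exists_monoPairs_eq_empty θ G))

end Symmetry

end CnSym

/-! The same placement and the same flex serve `G` and every graph of the closure sequence, so it
suffices that a flex keeps the distance of each added pair constant. This distance is continuous on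
a connected interval, so finitely many values are enough. If it took infinitely many values, the
squared distance would be a non-constant element of a field K ⊇ ℂ obtained from functions on the
flex, and some valuation ν trivial on ℂ would have a pole there. In the coordinates w = x + iy and z
= x - iy, rotations become scalars and squared lengths are products of a w- and a z-difference.
Along an edge this product is a non-zero constant, so the two values are inverse. Colouring edges by
whether ν of the w-difference is below a threshold gives a symmetric NAC-colouring, since each
colour class is cut out by an additive subgroup. On a path monochromatic for all these colourings ν
of the w-difference is the same on every edge, so by the ultrametric inequality the squared distance
of the ends has no pole, a contradiction. -/

namespace CnSym

/-! Valuations on function fields of parametrised families. -/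

/-- An element of a field extension of an algebraically closed field `k` which is not in `k` lies
outside some valuation ring containing `k`. -/
theorem exists_valuationSubring_notMem {k K : Type*} [Field k] [IsAlgClosed k] [Field K]
    [Algebra k K] {x : K} (hx : ∀ c : k, x ≠ algebraMap k K c) :
    ∃ A : ValuationSubring K, (∀ c : k, algebraMap k K c ∈ A) ∧ x ∉ A := by
  -- Valuation rings separate elements from an integrally closed subring; `k` is one because
  -- algebraic elements already lie in it.
  have hclosed : IsIntegrallyClosedIn (⊥ : Subalgebra k K).toSubring K := by
    refine Subring.isIntegrallyClosedIn_iff.2 fun {y} hy => ?_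
    have hy' : IsIntegral k y :=
      isIntegral_trans (R := k) (A := (⊥ : Subalgebra k K)) y hy
    exact minpoly.mem_range_of_degree_eq_one k y
      (IsAlgClosed.degree_eq_one_of_irreducible k (minpoly.irreducible hy'))
  obtain ⟨A, hA, hxA⟩ := Subring.exists_le_valuationSubring_of_isIntegrallyClosedIn
    (R := (⊥ : Subalgebra k K).toSubring) (x := x) (by
      rintro ⟨c, rfl⟩
      exact hx c rfl)
  exact ⟨A, fun c => hA ⟨c, rfl⟩, hxA⟩

/-- A function with infinitely many values is not constant in some residue field of the ring of all
functions. -/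
theorem exists_field_forall_ne {k : Type*} {I : Type} [Field k] {g : I → k}
    (hg : (Set.range g).Infinite) :
    ∃ P : Ideal (I → k), P.IsPrime ∧ ∀ c : k, g - algebraMap k (I → k) c ∉ P := by
  classical
  -- Functions on whose zero set `g` takes finitely many values. `S` contains every `g - c` but not
  -- 0, so a prime ideal can avoid it.
  let S : Submonoid (I → k) :=
    { carrier := {h | ∃ s : Finset k, ∀ i, h i = 0 → g i ∈ s}
      one_mem' := ⟨∅, fun i h => by simp at h⟩
      mul_mem' := by
        rintro a b ⟨s, hs⟩ ⟨t, ht⟩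
        refine ⟨s ∪ t, fun i h => ?_⟩
        rcases mul_eq_zero.1 h with h | h
        · exact Finset.mem_union_left _ (hs i h)
        · exact Finset.mem_union_right _ (ht i h) }
  obtain ⟨P, hP, -, hd⟩ := Ideal.exists_le_prime_disjoint (⊥ : Ideal (I → k)) S (by
    rw [Set.disjoint_left]
    rintro x hx ⟨s, hs⟩
    obtain rfl : x = 0 := by simpa using hx
    exact hg (s.finite_toSet.subset (by rintro _ ⟨i, rfl⟩; exact hs i rfl)))
  refine ⟨P, hP, fun c hc => Set.disjoint_left.1 hd hc ⟨{c}, fun i h => ?_⟩⟩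
  simpa [sub_eq_zero] using h

/-! Colourings defined by additive subgroups. -/

section Colourings

variable {V M : Type*} [AddCommGroup M]

theorem sub_mem_of_reachable {H : SimpleGraph V} {S : AddSubgroup M} {w : V → M}
    (h : ∀ a b, H.Adj a b → w a - w b ∈ S) {a b : V} (hab : H.Reachable a b) :
    w a - w b ∈ S := by
  obtain ⟨p⟩ := hab
  induction p with
  | nil => simp
  | cons hadj p ih => simpa using S.add_mem (h _ _ hadj) ih

theorem reachable_fromEdgeSet_of_walk {G : SimpleGraph V} {u v : V} (p : G.Walk u v) :
    (SimpleGraph.fromEdgeSet {e | e ∈ p.edges}).Reachable u v :=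
  ⟨p.transfer _ fun e he => by
    rw [SimpleGraph.edgeSet_fromEdgeSet]
    exact ⟨he, G.not_isDiag_of_mem_edgeSet (p.edges_subset_edgeSet he)⟩⟩

/-- The two ends of an edge of a cycle are joined by the other edges of the cycle. -/
theorem reachable_of_mem_edges_of_isCycle {G : SimpleGraph V} {v : V} {c : G.Walk v v}
    (hc : c.IsCycle) {a b : V} (hab : s(a, b) ∈ c.edges) :
    ((SimpleGraph.fromEdgeSet {e | e ∈ c.edges}).deleteEdges {s(a, b)}).Reachable a b := by
  have hmem : ∀ e ∈ c.edges, e ∈ (SimpleGraph.fromEdgeSet {e | e ∈ c.edges}).edgeSet := by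
    intro e he
    rw [SimpleGraph.edgeSet_fromEdgeSet]
    exact ⟨he, G.not_isDiag_of_mem_edgeSet (c.edges_subset_edgeSet he)⟩
  exact (SimpleGraph.adj_and_reachable_delete_edges_iff_exists_cycle.2
    ⟨v, c.transfer _ hmem, hc.transfer hmem, by rwa [SimpleGraph.Walk.edges_transfer]⟩).2

/-- A colouring whose colour classes are each given by differences lying in a subgroup is a
NAC-colouring as soon as both colours occur. -/
theorem isNAC_of_sub_mem {G : SimpleGraph V} {δ : G.edgeSet → Colour}
    {w : Colour → V → M} {S : Colour → AddSubgroup M} (hsurj : Function.Surjective δ)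
    (hδ : ∀ col u v (h : G.Adj u v), δ ⟨s(u, v), h⟩ = col ↔ w col u - w col v ∈ S col) :
    IsNAC δ := by
  refine ⟨hsurj, fun v c hc => or_iff_not_imp_left.2 fun hmono col => ?_⟩
  have hfin : {e : G.edgeSet | (e : Sym2 V) ∈ c.edges ∧ δ e = col}.Finite :=
    Set.Finite.subset ((List.finite_toSet c.edges).preimage Subtype.val_injective.injOn)
      fun e he => he.1
  by_contra hlt
  have hsub := (Set.ncard_le_one hfin).1 (by omega :
    {e : G.edgeSet | (e : Sym2 V) ∈ c.edges ∧ δ e = col}.ncard ≤ 1)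
  obtain ⟨col', hcol'⟩ : ∃ col', ∀ x : Colour, x ≠ col ↔ x = col' := by
    cases col
    · exact ⟨Colour.blue, by rintro ⟨⟩ <;> simp⟩
    · exact ⟨Colour.red, by rintro ⟨⟩ <;> simp⟩
  obtain ⟨⟨e, he⟩, hec, hecol⟩ : ∃ e : G.edgeSet, (e : Sym2 V) ∈ c.edges ∧ δ e = col := by
    by_contra! hno
    exact hmono fun e f he hf =>
      ((hcol' _).1 (hno e he)).trans ((hcol' _).1 (hno f hf)).symm
  induction e using Sym2.ind with
  | _ a b =>
    refine (hcol' (δ ⟨s(a, b), he⟩)).2 ?_ hecol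
    -- If `s(a, b)` is the only edge of its colour, the rest of the cycle puts the difference of its
    -- ends in the other subgroup, forcing the other colour.
    refine (hδ col' a b he).2
      (sub_mem_of_reachable (fun x y hxy => ?_) (reachable_of_mem_edges_of_isCycle hc hec))
    rw [SimpleGraph.deleteEdges_adj, SimpleGraph.fromEdgeSet_adj] at hxy
    have hadj : G.Adj x y := c.edges_subset_edgeSet hxy.1.1
    refine (hδ col' x y hadj).1 ((hcol' _).1 fun hxycol => hxy.2 ?_)
    have := hsub ⟨s(x, y), hadj⟩ ⟨hxy.1.1, hxycol⟩ ⟨s(a, b), he⟩ ⟨hec, hecol⟩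
    exact congrArg Subtype.val this

/-- The colouring of `isNAC_of_sub_mem` is symmetric if the group acts by operators which, together
with `γ - 1` for `γ ≠ 1`, preserve and reflect membership in the subgroups. -/
theorem isSymmetricNAC_of_sub_mem {K : Type*} [Field K] {n : ℕ} {θ : Cn n →* Equiv.Perm V}
    {G : SimpleGraph V} {δ : G.edgeSet → Colour}
    {w : Colour → V → K} {S : Colour → AddSubgroup K} (hsurj : Function.Surjective δ)
    (hδ : ∀ col u v (h : G.Adj u v), δ ⟨s(u, v), h⟩ = col ↔ w col u - w col v ∈ S col)
    (ζ : Colour → Cn n → K) (hw : ∀ col γ v, w col (θ γ v) = ζ col γ * w col v)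
    (hS : ∀ col γ x, ζ col γ * x ∈ S col ↔ x ∈ S col)
    (hS' : ∀ col γ x, γ ≠ 1 → (ζ col γ - 1) * x ∈ S col → x ∈ S col) :
    IsSymmetricNAC θ δ where
  nac := isNAC_of_sub_mem hsurj hδ
  invariant := by
    rintro γ ⟨e, he⟩ ⟨e', he'⟩ h
    induction e using Sym2.ind with
    | _ u v =>
      obtain rfl : e' = s(θ γ u, θ γ v) := h
      refine (hδ _ _ _ he').2 ?_
      rw [hw, hw, ← mul_sub, hS]
      exact (hδ _ _ _ he).1 rfl
  separated := by
    intro col H₁ H₂ hne h₁ h₂ u hu v hv hadj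
    have hreach : ∀ a b, (colourGraph δ col).Reachable a b → w col a - w col b ∈ S col := by
      refine fun a b => sub_mem_of_reachable fun x y hxy => ?_
      obtain ⟨⟨⟨e, he⟩, hcol, rfl⟩, -⟩ := (SimpleGraph.fromEdgeSet_adj _).1 hxy
      exact (hδ _ _ _ he).1 hcol
    -- Both `a` and `γ a` lie in `H`, so `(ζ γ - 1) * w a` is in the subgroup, and `hS'` removes the
    -- factor.
    have hmem : ∀ (H : (colourGraph δ col).ConnectedComponent), IsPartiallyInvariantSet θ H.supp →
        ∀ a ∈ H.supp, w col a ∈ S col := by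
      rintro H ⟨γ, hγ, hH⟩ a ha
      have ha' : θ γ a ∈ H.supp := hH ▸ Set.mem_image_of_mem _ ha
      have := hreach _ _ (SimpleGraph.ConnectedComponent.exact
        (((SimpleGraph.ConnectedComponent.mem_supp_iff _ _).1 ha').trans
          ((SimpleGraph.ConnectedComponent.mem_supp_iff _ _).1 ha).symm))
      rw [hw, ← sub_one_mul] at this
      exact hS' col γ _ hγ this
    have hcol := (hδ col u v hadj).2 ((S col).sub_mem (hmem H₁ h₁ u hu) (hmem H₂ h₂ v hv))
    refine hne ?_
    rw [← (SimpleGraph.ConnectedComponent.mem_supp_iff _ _).1 hu,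
      ← (SimpleGraph.ConnectedComponent.mem_supp_iff _ _).1 hv]
    exact SimpleGraph.ConnectedComponent.sound
      (SimpleGraph.Adj.reachable ((SimpleGraph.fromEdgeSet_adj _).2 ⟨⟨_, hcol, rfl⟩, hadj.ne⟩))

end Colourings

/-- Let `w` and `z` be the two isotropic coordinates of a symmetric placement over a valued field
whose edges have squared lengths of value one. If a walk is monochromatic for all symmetric
NAC-colourings, then the squared distance of its ends is integral. -/
theorem valuation_mul_le_one_of_isMonochromatic {V K Γ : Type*} [Field K]
    [LinearOrderedCommGroupWithZero Γ] (ν : Valuation K Γ) {n : ℕ} {θ : Cn n →* Equiv.Perm V}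
    {G : SimpleGraph V} {w z : V → K} {ζ ξ : Cn n → K}
    (hw : ∀ γ v, w (θ γ v) = ζ γ * w v) (hz : ∀ γ v, z (θ γ v) = ξ γ * z v)
    (hζ : ∀ γ, ν (ζ γ) = 1) (hξ : ∀ γ, ν (ξ γ) = 1)
    (hζ' : ∀ γ, γ ≠ 1 → ν (ζ γ - 1) = 1) (hξ' : ∀ γ, γ ≠ 1 → ν (ξ γ - 1) = 1)
    (hedge : ∀ u v, G.Adj u v → ν ((w u - w v) * (z u - z v)) = 1)
    {u v : V} (p : G.Walk u v)
    (hp : ∀ δ : G.edgeSet → Colour, IsSymmetricNAC θ δ → IsMonochromatic δ p) :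
    ν ((w u - w v) * (z u - z v)) ≤ 1 := by
  classical
  have hinv : ∀ a b, G.Adj a b → ν (z a - z b) = (ν (w a - w b))⁻¹ := fun a b h =>
    eq_inv_of_mul_eq_one_right (by rw [← map_mul, hedge a b h])
  have hne : ∀ a b, G.Adj a b → ν (w a - w b) ≠ 0 := fun a b h h0 => by
    simpa [h0] using hedge a b h
  have hconst : ∀ a b c d, s(a, b) ∈ p.edges → s(c, d) ∈ p.edges →
      ¬ ν (w a - w b) < ν (w c - w d) := by
    intro a b c d hab hcd hlt
    have hab' : G.Adj a b := p.edges_subset_edgeSet hab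
    have hcd' : G.Adj c d := p.edges_subset_edgeSet hcd
    -- The threshold at edge `cd` makes `ab` red and `cd` blue. Red is ν(w) < r; its negation r ≤
    -- ν(w) becomes the subgroup condition ν(z) ≤ r⁻¹.
    let r : Γˣ := Units.mk0 _ (hne c d hcd')
    let W : Colour → V → K := fun col => Colour.rec w z col
    let S : Colour → AddSubgroup K := fun col =>
      Colour.rec (ν.ltAddSubgroup r) (ν.leAddSubgroup ((r⁻¹ : Γˣ) : Γ)) col
    let Z : Colour → Cn n → K := fun col => Colour.rec ζ ξ col
    let δ : G.edgeSet → Colour := fun e =>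
      if ∃ x y, (e : Sym2 V) = s(x, y) ∧ ν (w x - w y) < r then Colour.red else Colour.blue
    have hred : ∀ x y (h : G.Adj x y),
        (∃ x' y', s(x, y) = s(x', y') ∧ ν (w x' - w y') < r) ↔ ν (w x - w y) < r := by
      refine fun x y h => ⟨?_, fun h' => ⟨x, y, rfl, h'⟩⟩
      rintro ⟨x', y', he, h'⟩
      rcases Sym2.eq_iff.1 he with ⟨rfl, rfl⟩ | ⟨rfl, rfl⟩
      · exact h'
      · rwa [ν.map_sub_swap]
    have hδ : ∀ col x y (h : G.Adj x y), δ ⟨s(x, y), h⟩ = col ↔ W col x - W col y ∈ S col := by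
      intro col x y h
      have hpos : 0 < ν (w x - w y) := zero_lt_iff.2 (hne x y h)
      cases col
      · simp only [δ, W, S, hred x y h, Valuation.mem_ltAddSubgroup_iff]
        split_ifs with hlt <;> simp [hlt]
      · simp only [δ, W, S, hred x y h, Valuation.mem_leAddSubgroup_iff, hinv x y h,
          Units.val_inv_eq_inv_val]
        rw [inv_le_inv₀ hpos (zero_lt_iff.2 r.ne_zero)]
        split_ifs with hlt <;> simpa using hlt
    have hda : δ ⟨s(a, b), hab'⟩ = Colour.red := (hδ _ _ _ _).2 hlt
    have hdc : δ ⟨s(c, d), hcd'⟩ = Colour.blue := by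
      refine (hδ _ _ _ _).2 ?_
      simp [W, S, r, hinv c d hcd']
    have hsymm : IsSymmetricNAC θ δ := by
      refine isSymmetricNAC_of_sub_mem ?_ hδ Z ?_ ?_ ?_
      · rintro ⟨⟩
        exacts [⟨_, hda⟩, ⟨_, hdc⟩]
      · rintro ⟨⟩ γ x
        exacts [hw γ x, hz γ x]
      · rintro ⟨⟩ γ x <;> simp [S, Z, hζ, hξ]
      · rintro ⟨⟩ γ x hγ <;> simp [S, Z, hζ' γ hγ, hξ' γ hγ]
    have := hp δ hsymm ⟨_, hab'⟩ ⟨_, hcd'⟩ hab hcd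
    rw [hda, hdc] at this
    cases this
  rcases p.edges.eq_nil_or_concat with hnil | ⟨l, e, he⟩
  · have : u = v := p.eq_of_length_eq_zero (by rw [← p.length_edges, hnil]; rfl)
    simp [this]
  · induction e using Sym2.ind with
    | _ c d =>
      have hcd : s(c, d) ∈ p.edges := by simp [he]
      have hcd' : G.Adj c d := p.edges_subset_edgeSet hcd
      have h1 : w u - w v ∈ ν.leAddSubgroup (ν (w c - w d)) := by
        refine sub_mem_of_reachable (fun x y hxy => ?_) (reachable_fromEdgeSet_of_walk p)
        exact not_lt.1 (hconst c d x y hcd ((SimpleGraph.fromEdgeSet_adj _).1 hxy).1)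
      have h2 : z u - z v ∈ ν.leAddSubgroup (ν (w c - w d))⁻¹ := by
        refine sub_mem_of_reachable (fun x y hxy => ?_) (reachable_fromEdgeSet_of_walk p)
        have hmem := ((SimpleGraph.fromEdgeSet_adj _).1 hxy).1
        have hadj : G.Adj x y := p.edges_subset_edgeSet hmem
        rw [Valuation.mem_leAddSubgroup_iff, hinv x y hadj,
          inv_le_inv₀ (zero_lt_iff.2 (hne x y hadj)) (zero_lt_iff.2 (hne c d hcd'))]
        exact not_lt.1 (hconst x y c d hmem hcd)
      rw [map_mul, ← mul_inv_cancel₀ (hne c d hcd')]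
      exact mul_le_mul' h1 h2

/-! Isotropic coordinates of the plane. -/

/-- The point `(x, y)` as the complex number `x + s y i`. -/
noncomputable def isotropic (s : ℂ) (x : Plane) : ℂ := x 0 + s * x 1 * Complex.I

/-- The forms x ± iy are common eigenvectors of all rotations; `s ^ 2 = 1` treats both signs at
once. -/
theorem isotropic_rotate {s : ℂ} (hs : s ^ 2 = 1) (α : ℝ) (x : Plane) :
    isotropic s (rotate α x) = Complex.exp (s * α * Complex.I) * isotropic s x := by
  have hcs : Complex.exp (s * α * Complex.I) =
      Complex.cos α + s * Complex.sin α * Complex.I := by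
    rcases sq_eq_sq_iff_eq_or_eq_neg.1 (hs.trans (one_pow 2).symm) with rfl | rfl
    · simp [Complex.exp_mul_I]
    · rw [neg_one_mul, ← Complex.ofReal_neg, Complex.exp_mul_I]
      simp
  rw [hcs]
  simp only [isotropic, rotate]
  simp only [Matrix.cons_val_zero, Matrix.cons_val_one]
  push_cast
  linear_combination (-(Complex.sin α * x 1 * s ^ 2)) * Complex.I_sq + Complex.sin α * x 1 * hs

theorem isotropic_sub_mul (x y : Plane) :
    (isotropic 1 x - isotropic 1 y) * (isotropic (-1) x - isotropic (-1) y) =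
      ((‖x - y‖ ^ 2 : ℝ) : ℂ) := by
  rw [EuclideanSpace.norm_sq_eq]
  simp [isotropic, Fin.sum_univ_two]
  linear_combination (-((x 1 : ℂ) - y 1) ^ 2) * Complex.I_sq

/-- Non-zero scalars have value one for a valuation ring containing all scalars. -/
theorem valuation_algebraMap_eq_one {k K : Type*} [Field k] [Field K] [Algebra k K]
    {A : ValuationSubring K} (hA : ∀ c : k, algebraMap k K c ∈ A) {c : k} (hc : c ≠ 0) :
    A.valuation (algebraMap k K c) = 1 := by
  refine le_antisymm ((A.valuation_le_one_iff _).2 (hA c)) ?_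
  have h := (A.valuation_le_one_iff _).2 (hA c⁻¹)
  rw [map_inv₀, map_inv₀] at h
  have hpos : 0 < A.valuation (algebraMap k K c) :=
    zero_lt_iff.2 ((map_ne_zero _).2 ((map_ne_zero _).2 hc))
  exact (inv_le_one₀ hpos).1 h

/-- Makes `ζ γ - 1` a non-zero scalar, hence of value one, as the separation of partially invariant
components requires. -/
theorem exp_rotation_ne_one {n : ℕ} (hn : n ≠ 0) {s : ℂ} (hs : s ^ 2 = 1) {γ : Cn n} (hγ : γ ≠ 1) :
    Complex.exp (s * ((2 * ((Multiplicative.toAdd γ).val : ℝ) * Real.pi / (n : ℝ) : ℝ) : ℂ) *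
      Complex.I) ≠ 1 := by
  have : NeZero n := ⟨hn⟩
  have hexp : Complex.exp (((2 * ((Multiplicative.toAdd γ).val : ℝ) * Real.pi / (n : ℝ) : ℝ) : ℂ) *
      Complex.I) ≠ 1 := by
    rw [Ne, Complex.exp_eq_one_iff]
    rintro ⟨m, hm⟩
    have hn' : (n : ℂ) ≠ 0 := Nat.cast_ne_zero.2 hn
    have hπ : (2 * Real.pi * Complex.I : ℂ) ≠ 0 := Complex.two_pi_I_ne_zero
    have h1 : (((Multiplicative.toAdd γ).val : ℤ) : ℂ) = ((m * n : ℤ) : ℂ) := by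
      push_cast at hm ⊢
      field_simp at hm
      exact hm.trans (mul_comm _ _)
    have h2 : ((Multiplicative.toAdd γ).val : ℤ) = m * n := by exact_mod_cast h1
    have h3 : (Multiplicative.toAdd γ).val = 0 :=
      Nat.eq_zero_of_dvd_of_lt (Int.natCast_dvd_natCast.1 ⟨m, by rw [h2, mul_comm]⟩)
        (ZMod.val_lt _)
    exact hγ ((ZMod.val_eq_zero _).1 h3)
  rcases sq_eq_sq_iff_eq_or_eq_neg.1 (hs.trans (one_pow 2).symm) with rfl | rfl
  · simpa using hexp
  · rw [neg_mul, neg_mul, one_mul, Complex.exp_neg]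
    simpa using hexp

/-- In a family of symmetric placements with constant edge lengths, the distance of two vertices
joined by a walk which is monochromatic for all symmetric NAC-colourings takes finitely many
values. -/
theorem finite_range_norm_sub {V : Type*} {n : ℕ} (hn : n ≠ 0) {θ : Cn n →* Equiv.Perm V}
    {G : SimpleGraph V} {I : Type} {f : I → V → Plane} {p : V → Plane}
    (hp : IsPlacement G p) (hf : ∀ t, AreEquivalent G (f t) p)
    (hsym : ∀ t, IsSymmetricPlacement θ (f t)) {u v : V} (P : G.Walk u v)
    (hP : ∀ δ : G.edgeSet → Colour, IsSymmetricNAC θ δ → IsMonochromatic δ P) :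
    (Set.range fun t => ‖f t u - f t v‖).Finite := by
  by_contra hinf
  let g : I → ℂ := fun t => ((‖f t u - f t v‖ ^ 2 : ℝ) : ℂ)
  have hg : (Set.range g).Infinite := by
    have hinj : Set.InjOn (fun x : ℝ => ((x ^ 2 : ℝ) : ℂ)) (Set.range fun t => ‖f t u - f t v‖) := by
      rintro _ ⟨a, rfl⟩ _ ⟨b, rfl⟩ hab
      exact (pow_left_inj₀ (norm_nonneg _) (norm_nonneg _) two_ne_zero).1
        (Complex.ofReal_injective hab)
    have := Set.Infinite.image hinj hinf
    rwa [← Set.range_comp] at this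
  obtain ⟨Q, hQ, hQg⟩ := exists_field_forall_ne hg
  -- Over `K` the whole family becomes a single placement, in which `g` is not a scalar.
  let K := FractionRing ((I → ℂ) ⧸ Q)
  let φ : (I → ℂ) →+* K := (algebraMap ((I → ℂ) ⧸ Q) K).comp (Ideal.Quotient.mk Q)
  let : Algebra ℂ K := (φ.comp (algebraMap ℂ (I → ℂ))).toAlgebra
  have hφ : ∀ c : ℂ, algebraMap ℂ K c = φ (fun _ => c) := fun _ => rfl
  have hker : ∀ x, φ x = 0 → x ∈ Q := fun x hx =>
    Ideal.Quotient.eq_zero_iff_mem.1 ((map_eq_zero_iff _ (IsFractionRing.injective _ K)).1 hx)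
  obtain ⟨A, hA, hgA⟩ := exists_valuationSubring_notMem (k := ℂ) (x := φ g) fun c hc =>
    hQg c (hker _ (by rw [map_sub, hc]; exact sub_self _))
  refine hgA ((A.valuation_le_one_iff _).1 ?_)
  let coord : ℂ → V → K := fun s v => φ fun t => isotropic s (f t v)
  let ζ : ℂ → Cn n → ℂ := fun s γ => Complex.exp (s *
    ((2 * ((Multiplicative.toAdd γ).val : ℝ) * Real.pi / (n : ℝ) : ℝ) : ℂ) * Complex.I)
  have hone : (1 : ℂ) ^ 2 = 1 := one_pow 2
  have hneg : (-1 : ℂ) ^ 2 = 1 := neg_one_sq.trans rfl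
  have hact : ∀ s : ℂ, s ^ 2 = 1 → ∀ γ v,
      coord s (θ γ v) = algebraMap ℂ K (ζ s γ) * coord s v := by
    intro s hs γ v
    rw [hφ, ← map_mul]
    refine congrArg φ (funext fun t => ?_)
    simp only [Pi.mul_apply, hsym t γ v, isotropic_rotate hs, ζ]
  have hval : ∀ s γ, A.valuation (algebraMap ℂ K (ζ s γ)) = 1 := fun s γ =>
    valuation_algebraMap_eq_one hA (Complex.exp_ne_zero _)
  have hval' : ∀ s : ℂ, s ^ 2 = 1 → ∀ γ, γ ≠ 1 →
      A.valuation (algebraMap ℂ K (ζ s γ) - 1) = 1 := by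
    intro s hs γ hγ
    rw [← map_one (algebraMap ℂ K), ← map_sub]
    exact valuation_algebraMap_eq_one hA (sub_ne_zero.2 (exp_rotation_ne_one hn hs hγ))
  have hmul : ∀ a b, (coord 1 a - coord 1 b) * (coord (-1) a - coord (-1) b) =
      φ fun t => ((‖f t a - f t b‖ ^ 2 : ℝ) : ℂ) := by
    intro a b
    rw [← map_sub, ← map_sub, ← map_mul]
    exact congrArg φ (funext fun t => isotropic_sub_mul _ _)
  have hmain := valuation_mul_le_one_of_isMonochromatic A.valuation (hact 1 hone) (hact (-1) hneg)
    (hval 1) (hval (-1)) (hval' 1 hone) (hval' (-1) hneg) (fun a b hab => by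
      rw [hmul]
      simp only [hf _ a b hab]
      rw [← hφ]
      refine valuation_algebraMap_eq_one hA (Complex.ofReal_ne_zero.2 (pow_ne_zero 2 ?_))
      exact norm_ne_zero_iff.2 (sub_ne_zero.2 (hp a b hab))) P hP
  rwa [hmul] at hmain

/-! Flexes of the closure. -/

theorem eq_of_finite_range {X Y : Type*} [TopologicalSpace X] [PreconnectedSpace X]
    [TopologicalSpace Y] [T1Space Y] {g : X → Y} (hg : Continuous g) (h : (Set.range g).Finite)
    (a b : X) : g a = g b := by
  by_contra hne
  exact (isPreconnected_range hg).infinite_of_nontrivial ⟨_, ⟨a, rfl⟩, _, ⟨b, rfl⟩, hne⟩ h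

section Flexes

variable {V : Type*} {n : ℕ} {θ : Cn n →* Equiv.Perm V}

theorem IsProperFlexible.mono {G H : SimpleGraph V} (hGH : G ≤ H) {p : V → Plane}
    (h : IsProperFlexible θ H p) : IsProperFlexible θ G p := by
  obtain ⟨hp, hsym, f, hf, hrest⟩ := h
  exact ⟨fun u v huv => hp u v (hGH huv), hsym, f,
    ⟨hf.continuous, hf.start, fun t u v huv => hf.placement t u v (hGH huv),
      fun t u v huv => hf.equivalent t u v (hGH huv)⟩, hrest⟩

theorem IsProperFlexible.addMonoPairs (hn : n ≠ 0) {G : SimpleGraph V} {p : V → Plane}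
    (h : IsProperFlexible θ G p) : IsProperFlexible θ (addMonoPairs θ G) p := by
  obtain ⟨hp, hsym, f, hf, ⟨t₀, ht₀⟩, hfsym, hfin⟩ := h
  -- Otherwise the flex has finite range, hence is constant. The injective placement shows below
  -- that the constant distances of added pairs are non-zero.
  obtain ⟨t₁, ht₁⟩ : ∃ t, Function.Injective (f t) := by
    by_contra! hno
    refine ht₀ fun u v => ?_
    have : f t₀ = f 0 := eq_of_finite_range hf.continuous
      (hfin.subset (by rintro _ ⟨t, rfl⟩; exact ⟨⟨t, rfl⟩, hno t⟩)) _ _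
    rw [this, hf.start]
  have hdist : ∀ u v, s(u, v) ∈ monoPairs θ G → ∀ t t', ‖f t u - f t v‖ = ‖f t' u - f t' v‖ := by
    rintro u v ⟨a, b, he, -, -, P, -, hP⟩ t t'
    have hab : ‖f t a - f t b‖ = ‖f t' a - f t' b‖ :=
      eq_of_finite_range (g := fun t => ‖f t a - f t b‖)
        (((continuous_apply a).comp hf.continuous).sub
          ((continuous_apply b).comp hf.continuous)).norm
        (finite_range_norm_sub hn hp hf.equivalent hfsym P hP) t t'
    rcases Sym2.eq_iff.1 he with ⟨rfl, rfl⟩ | ⟨rfl, rfl⟩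
    · exact hab
    · rwa [norm_sub_rev (f t _), norm_sub_rev (f t' _)]
  have hequiv : ∀ t, AreEquivalent (CnSym.addMonoPairs θ G) (f t) p := by
    intro t u v huv
    rcases ((SimpleGraph.fromEdgeSet_adj _).1 huv).1 with h | h
    · exact hf.equivalent t u v h
    · rw [hdist u v h t 0, hf.start]
  have hplace : ∀ t, IsPlacement (CnSym.addMonoPairs θ G) (f t) := by
    intro t u v huv
    rw [← sub_ne_zero, ← norm_ne_zero_iff, hequiv t u v huv, ← hequiv t₁ u v huv,
      norm_ne_zero_iff, sub_ne_zero]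
    exact ht₁.ne huv.ne
  exact ⟨hf.start ▸ hplace 0, hsym, f, ⟨hf.continuous, hf.start, hplace, hequiv⟩, ⟨t₀, ht₀⟩,
    hfsym, hfin⟩

theorem isProperFlexible_closureSeq_iff (hn : n ≠ 0) {G : SimpleGraph V} {p : V → Plane} (k : ℕ) :
    IsProperFlexible θ (closureSeq θ G k) p ↔ IsProperFlexible θ G p := by
  induction k with
  | zero => rfl
  | succ k ih =>
    exact ⟨fun h => ih.1 (h.mono (le_addMonoPairs θ _)), fun h => (ih.2 h).addMonoPairs hn⟩

theorem not_admitsProperFlexible_top : ¬ AdmitsProperFlexible θ (⊤ : SimpleGraph V) := by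
  rintro ⟨p, -, -, f, hf, ⟨t, ht⟩, -⟩
  refine ht fun u v => ?_
  by_cases huv : u = v
  · simp [huv]
  · exact hf.equivalent t u v huv

end Flexes

end CnSym

theorem mainTheorem4 {V : Type*} [Finite V] (n : ℕ) (hn : 2 ≤ n)
    (θ : CnSym.Cn n →* Equiv.Perm V) (G : SimpleGraph V) (hG : CnSym.IsSymmetricGraph θ G) :
    (CnSym.AdmitsProperFlexible θ G ↔
      CnSym.AdmitsProperFlexible θ (CnSym.constantDistanceClosure θ G)) ∧
    (CnSym.constantDistanceClosure θ G = ⊤ → ¬ CnSym.AdmitsProperFlexible θ G) := by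
  have hiff : CnSym.AdmitsProperFlexible θ G ↔
      CnSym.AdmitsProperFlexible θ (CnSym.constantDistanceClosure θ G) :=
    exists_congr fun p => (CnSym.isProperFlexible_closureSeq_iff (by omega) _).symm
  refine ⟨hiff, fun htop h => ?_⟩
  have h' := hiff.1 h
  rw [htop] at h'
  exact CnSym.not_admitsProperFlexible_top h'
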